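/- Let $k$ be a field of characteristic $2$ and let $G$ be a finite abelian $2$-group which has $C_2$ as a direct summand. Call a map of $kG$-modules \emph{stably trivial} if it factors through a projective $kG$-module. Let $\Omega^i k$ $(i\in\mathbb Z)$ denote the iterated (co)syzygies of the trivial module $k$, where $\Omega X$ is the kernel of an epimorphism from a projective module onto $X$ and $\Omega^{-1}X$ is the cokernel of a monomorphism from $X$ into an injective (equivalently, projective) module. A map $f\colon M\to N$ of $kG$-modules is a \emph{ghost} if for every integer $i$ the induced map $\underline{\mathrm{Hom}}_{kG}(\Omega^i k,M)\to\underline{\mathrm{Hom}}_{kG}(\Omega^i k,N)$ is zero, where $\underline{\mathrm{Hom}}_{kG}$ denotes $kG$-homomorphisms modulo stably trivial ones; that is, $f$ induces the zero map on Tate cohomology. The \emph{ghost number} of $kG$ is the smallest non-negative integer $l$ such that every composite of $l$ ghosts between finite-dimensional $kG$-modules is stably trivial. The \emph{nilpotency index} of the Jacobson radical $J(kG)$ is the smallest integer $m\ge 0$ with $J(kG)^m=0$. Then the ghost number of $kG$ and the nilpotency index of $J(kG)$ both exist, and $$\text{ghost number of } kG \;=\; (\text{nilpotency index of } J(kG))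 - 1 .$$ -/

import Mathlib

open CategoryTheory CategoryTheory.Limits

universe u

namespace GhostNumber

/-- The category of left `kG`-modules has enough injectives. -/
instance enoughInjectives_rep (k G : Type u) [CommRing k] [Group G] :
    EnoughInjectives (Rep.{u} k G) :=
  EnoughInjectives.of_equivalence Rep.equivalenceModuleMonoidAlgebra.functor

section

variable {k G : Type u} [Field k] [Group G]

/-- A map of `kG`-modules is stably trivial (zero in the stable module category `StMod(kG)`)
if it factors through a projective `kG`-module. -/
def StablyTrivial {M N : Rep.{u} k G} (f : M ⟶ N) : Prop :=
  ∃ (P : Rep.{u} k G) (a : M ⟶ P) (b : P ⟶ N), Projective P ∧ a ≫ b = f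

/-- `Ω M`: the kernel of an epimorphism from a projective module onto `M`. -/
noncomputable def syzygy (M : Rep.{u} k G) : Rep.{u} k G :=
  kernel (Projective.π M)

/-- `Ω⁻¹ M`: the cokernel of a monomorphism from `M` into an injective module (for a finite group
over a field, injective and projective modules coincide). -/
noncomputable def cosyzygy (M : Rep.{u} k G) : Rep.{u} k G :=
  cokernel (Injective.ι M)

/-- `Ωⁱ M` for an arbitrary integer `i`. -/
noncomputable def heller (M : Rep.{u} k G) : ℤ → Rep.{u} k G
  | Int.ofNat n => syzygy^[n] M
  | Int.negSucc n => cosyzygy^[n + 1] M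

/-- A map `f : M ⟶ N` is a ghost if, for every integer `i`, the induced map
`Hom(Ωⁱ k, M) ⟶ Hom(Ωⁱ k, N)` of stable Hom groups (the Tate cohomology groups) is zero. -/
def IsGhost {M N : Rep.{u} k G} (f : M ⟶ N) : Prop :=
  ∀ (i : ℤ) (φ : heller (Rep.trivial k G k) i ⟶ M), StablyTrivial (φ ≫ f)

/-- `IsGhostComposite l f` says that `f` is a composite of `l` ghosts between finite-dimensional
`kG`-modules (for `l = 0`, that `f` is the identity of a finite-dimensional `kG`-module). -/
inductive IsGhostComposite : ℕ → ∀ {M N : Rep.{u} k G}, (M ⟶ N) → Prop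
  | id (M : Rep.{u} k G) (hM : FiniteDimensional k M) : IsGhostComposite 0 (𝟙 M)
  | comp {l : ℕ} {L M N : Rep.{u} k G} (f : L ⟶ M) (g : M ⟶ N)
      (hL : FiniteDimensional k L) (hf : IsGhost f) (hg : IsGhostComposite l g) :
      IsGhostComposite (l + 1) (f ≫ g)

end

/-- `l` is the ghost number of `kG`: the smallest non-negative integer such that the composite of
any `l` ghosts between finite-dimensional `kG`-modules is stably trivial. -/
def IsGhostNumber (k G : Type u) [Field k] [Group G] (l : ℕ) : Prop :=
  IsLeast {n : ℕ | ∀ (M N : Rep.{u} k G) (f : M ⟶ N), IsGhostComposite n f → StablyTrivial f} l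

/-- `m` is the nilpotency index of the ideal `I`: the smallest natural number with `I ^ m = 0`. -/
def IsNilpotencyIndex {R : Type*} [CommRing R] (I : Ideal R) (m : ℕ) : Prop :=
  IsLeast {n : ℕ | I ^ n = ⊥} m

end GhostNumber

/-! Write J for the radical and l + 1 for its nilpotency index. Stably trivial maps are exactly the
relative traces of k-linear maps (`stablyTrivial_iff`), which makes both bounds computable.

Upper bound: subtracting a trace from a ghost makes it vanish on the invariants, so it factors
through the quotient by them. Iterating, a composite of l ghosts is stably a map killing everything
annihilated by J ^ l. As J ^ (l + 1) = 0, every element of J ^ l is a multiple of the norm element,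
so that map kills the kernel of the norm, and any such map is a trace.

Lower bound: an element of J kills k, hence acts stably as zero on every Ωⁱ k, so multiplication by
it is a ghost on every module. Let σ generate the summand C₂ and let G act on kG through the
projection π killing σ. There all traces vanish, so stably trivial means zero, and it suffices that
π does not kill J ^ (l - 1). If it did, J ^ l would lie in the ideal (σ - 1)² = 0. -/

namespace GhostNumber

/-! ### Relative traces and projectivity (Higman's criterion) -/

section RelativeTrace

variable {k G : Type u} [Field k] [Group G] [Fintype G] {L M N K : Rep.{u} k G}

/-- The relative trace `∑ g, g⁻¹ ∘ h ∘ g` of a `k`-linear map `h` between `kG`-modules. -/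
noncomputable def relTrace (h : M →ₗ[k] N) : M ⟶ N :=
  Rep.ofHom (ρ := M.ρ) (σ := N.ρ)
    (LinearMap.intertwiningMap_of_isIntertwiningMap M.ρ N.ρ
      (∑ g : G, N.ρ g⁻¹ ∘ₗ h ∘ₗ M.ρ g) fun g v ↦ by
        simp only [LinearMap.sum_apply, LinearMap.comp_apply, map_sum]
        refine Fintype.sum_bijective (· * g) (Group.mulRight_bijective g) _ _ fun x ↦ ?_
        simp only [← Module.End.mul_apply, ← map_mul]
        simp)

lemma relTrace_apply (h : M →ₗ[k] N) (v : M) :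
    (relTrace h).hom v = ∑ g : G, N.ρ g⁻¹ (h (M.ρ g v)) := by
  change (∑ g : G, N.ρ g⁻¹ ∘ₗ h ∘ₗ M.ρ g) v = _
  simp

lemma relTrace_add (h₁ h₂ : M →ₗ[k] N) : relTrace (h₁ + h₂) = relTrace h₁ + relTrace h₂ := by
  ext v
  change (relTrace (h₁ + h₂)).hom v = (relTrace h₁).hom v + (relTrace h₂).hom v
  simp [relTrace_apply, Finset.sum_add_distrib]

lemma relTrace_comp (h : M →ₗ[k] N) (f : N ⟶ K) :
    relTrace h ≫ f = relTrace (f.hom.toLinearMap ∘ₗ h) := by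
  ext v
  change f.hom ((relTrace h).hom v) = (relTrace (f.hom.toLinearMap ∘ₗ h)).hom v
  simp [relTrace_apply, Rep.hom_comm_apply]

lemma comp_relTrace (f : L ⟶ M) (h : M →ₗ[k] N) :
    f ≫ relTrace h = relTrace (h ∘ₗ f.hom.toLinearMap) := by
  ext v
  change (relTrace h).hom (f.hom v) = (relTrace (h ∘ₗ f.hom.toLinearMap)).hom v
  simp [relTrace_apply, Rep.hom_comm_apply]

/-- The representation on functions from `G` to `V` by right translation of the argument. -/
def functionRepresentation (k G V : Type u) [Field k] [Group G] [AddCommGroup V] [Module k V] :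
    Representation k G (G → V) where
  toFun g := LinearMap.funLeft k V (· * g)
  map_one' := by ext F x; simp [LinearMap.funLeft_apply]
  map_mul' g h := by ext F x; simp [LinearMap.funLeft_apply, mul_assoc]

/-- The `kG`-module of functions from `G` to the vector space underlying `M`. -/
abbrev functionRep (M : Rep.{u} k G) : Rep.{u} k G :=
  Rep.of (functionRepresentation k G M)

/-- The embedding of `M` in the module of functions, sending `v` to its orbit map. -/
def toFunctionRep (M : Rep.{u} k G) : M ⟶ functionRep M :=
  Rep.ofHom (ρ := M.ρ) (σ := functionRepresentation k G M)
    (LinearMap.intertwiningMap_of_isIntertwiningMap M.ρ (functionRepresentation k G M)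
      (LinearMap.pi fun g ↦ M.ρ g) fun g v ↦ by
        ext x
        change M.ρ x (M.ρ g v) = M.ρ (x * g) v
        simp)

/-- The translates of the projection to the coordinate at 1 are the projections to all the
coordinates, and these sum to the identity. -/
lemma functionRep_id (M : Rep.{u} k G) :
    ∃ h : functionRep M →ₗ[k] functionRep M, relTrace h = 𝟙 (functionRep M) := by
  classical
  refine ⟨(LinearMap.single k (fun _ : G ↦ (M : Type u)) 1) ∘ₗ LinearMap.proj (1 : G), ?_⟩
  refine Rep.hom_ext (Representation.IntertwiningMap.ext (LinearMap.ext fun F : G → M ↦ ?_))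
  refine (relTrace_apply (M := functionRep M) _ F).trans (funext fun x ↦ ?_)
  refine (Finset.sum_apply x _ _).trans ?_
  rw [Finset.sum_eq_single x]
  · change Pi.single (M := fun _ : G ↦ (M : Type u)) 1 (F (1 * x)) (x * x⁻¹) = F x
    simp
  · intro g _ hg
    change Pi.single (M := fun _ : G ↦ (M : Type u)) 1 (F (1 * g)) (x * g⁻¹) = 0
    rw [Pi.single_eq_of_ne]
    rwa [Ne, mul_inv_eq_one, eq_comm]
  · simp

/-- The sum `∑ g, g⁻¹ (F g)` for a function `F` on `G`. -/
noncomputable def ofFunctionRep (M : Rep.{u} k G) : functionRep M ⟶ M :=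
  relTrace (M := functionRep M) (N := M) (LinearMap.proj (1 : G))

lemma ofFunctionRep_surjective (M : Rep.{u} k G) : Function.Surjective (ofFunctionRep M).hom := by
  classical
  intro v
  refine ⟨(Pi.single (1 : G) v : G → M), ?_⟩
  refine (relTrace_apply (M := functionRep M) _ _).trans ?_
  rw [Finset.sum_eq_single 1]
  · change M.ρ 1⁻¹ ((Pi.single (1 : G) v : G → M) (1 * 1)) = v
    simp
  · intro g _ hg
    change M.ρ g⁻¹ ((Pi.single (1 : G) v : G → M) (1 * g)) = 0
    simp [hg]
  · simp

/-- A k-linear section of the epimorphism, composed with `h` and then traced, becomes an equivariant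
lift. -/
lemma projective_of_relTrace_eq_id {P : Rep.{u} k G} {h : P →ₗ[k] P} (hh : relTrace h = 𝟙 P) :
    Projective P where
  factors {E X} f e he := by
    obtain ⟨s, hs⟩ := LinearMap.exists_rightInverse_of_surjective e.hom.toLinearMap
      (LinearMap.range_eq_top.2 ((Rep.epi_iff_surjective e).1 he))
    refine ⟨relTrace (s ∘ₗ f.hom.toLinearMap ∘ₗ h), ?_⟩
    rw [relTrace_comp, ← LinearMap.comp_assoc, hs, LinearMap.id_comp, ← relTrace_comp, hh,
      Category.id_comp]

lemma projective_exists_relTrace {P : Rep.{u} k G} (hP : Projective P) :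
    ∃ h : P →ₗ[k] P, relTrace h = 𝟙 P := by
  have : Epi (ofFunctionRep P) := (Rep.epi_iff_surjective _).2 (ofFunctionRep_surjective P)
  obtain ⟨h, hh⟩ := functionRep_id P
  refine ⟨(ofFunctionRep P).hom.toLinearMap ∘ₗ h ∘ₗ
    (Projective.factorThru (𝟙 P) (ofFunctionRep P)).hom.toLinearMap, ?_⟩
  rw [← relTrace_comp, ← comp_relTrace, hh, Category.comp_id, Projective.factorThru_comp]

/-- Injective modules over the group algebra of a finite group are projective. -/
lemma projective_of_injective {I : Rep.{u} k G} (hI : Injective I) : Projective I := by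
  have : Mono (toFunctionRep I) := by
    refine (Rep.mono_iff_injective _).2 fun v w h ↦ ?_
    have h₁ : I.ρ 1 v = I.ρ 1 w := congrFun (f := fun g ↦ I.ρ g v) (g := fun g ↦ I.ρ g w) h 1
    simpa using h₁
  obtain ⟨h, hh⟩ := functionRep_id I
  refine projective_of_relTrace_eq_id (h := (Injective.factorThru (𝟙 I)
    (toFunctionRep I)).hom.toLinearMap ∘ₗ h ∘ₗ (toFunctionRep I).hom.toLinearMap) ?_
  rw [← relTrace_comp, ← comp_relTrace, hh, Category.comp_id, Injective.comp_factorThru]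

/-- A map factors through a projective module if and only if it is a relative trace. -/
lemma stablyTrivial_iff {f : M ⟶ N} : StablyTrivial f ↔ ∃ h : M →ₗ[k] N, relTrace h = f := by
  constructor
  · rintro ⟨P, a, b, hP, rfl⟩
    obtain ⟨h, hh⟩ := projective_exists_relTrace hP
    refine ⟨b.hom.toLinearMap ∘ₗ h ∘ₗ a.hom.toLinearMap, ?_⟩
    rw [← relTrace_comp, ← comp_relTrace, hh, Category.comp_id]
  · rintro ⟨h, rfl⟩
    obtain ⟨t, ht⟩ := functionRep_id M
    refine ⟨functionRep M, toFunctionRep M,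
      relTrace (M := functionRep M) (h ∘ₗ LinearMap.proj (1 : G)),
      projective_of_relTrace_eq_id ht, ?_⟩
    rw [comp_relTrace]
    congr 1
    ext v
    change h (M.ρ 1 v) = h v
    simp

lemma StablyTrivial.add {f g : M ⟶ N} (hf : StablyTrivial f) (hg : StablyTrivial g) :
    StablyTrivial (f + g) := by
  rw [stablyTrivial_iff] at *
  obtain ⟨h, rfl⟩ := hf
  obtain ⟨h', rfl⟩ := hg
  exact ⟨h + h', relTrace_add h h'⟩

end RelativeTrace

section

variable {k G : Type u} [Field k] [Group G] {L M N K : Rep.{u} k G}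

lemma StablyTrivial.comp_left {g : M ⟶ N} (hg : StablyTrivial g) (f : L ⟶ M) :
    StablyTrivial (f ≫ g) := by
  obtain ⟨P, a, b, hP, rfl⟩ := hg
  exact ⟨P, f ≫ a, b, hP, by simp⟩

lemma StablyTrivial.comp_right {f : M ⟶ N} (hf : StablyTrivial f) (g : N ⟶ K) :
    StablyTrivial (f ≫ g) := by
  obtain ⟨P, a, b, hP, rfl⟩ := hf
  exact ⟨P, a, b ≫ g, hP, by simp⟩

end

/-! ### Multiplication by group algebra elements, and ghosts -/

section CentralAction

variable {k G : Type u} [Field k] [CommGroup G] {L M N : Rep.{u} k G}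

/-- Multiplication by an element of the commutative group algebra, as a map of modules. -/
noncomputable def mulBy (z : MonoidAlgebra k G) (M : Rep.{u} k G) : M ⟶ M :=
  Rep.ofHom (Representation.IntertwiningMap.centralAlgebraMul M.ρ (z := z)
    (Submonoid.mem_center_iff.2 fun w ↦ mul_comm w z))

lemma hom_asAlgebraHom (f : M ⟶ N) (z : MonoidAlgebra k G) (v : M) :
    f.hom (M.ρ.asAlgebraHom z v) = N.ρ.asAlgebraHom z (f.hom v) := by
  induction z using MonoidAlgebra.induction_on with
  | of g => simpa using Rep.hom_comm_apply f g v
  | add x y hx hy => simp [hx, hy]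
  | smul r x hx => simp [hx]

lemma mulBy_comp (z : MonoidAlgebra k G) (f : M ⟶ N) : mulBy z M ≫ f = f ≫ mulBy z N := by
  ext v
  exact hom_asAlgebraHom f z v

lemma mulBy_mul (z w : MonoidAlgebra k G) : mulBy (z * w) M = mulBy w M ≫ mulBy z M := by
  ext v
  change M.ρ.asAlgebraHom (z * w) v = M.ρ.asAlgebraHom z (M.ρ.asAlgebraHom w v)
  simp

lemma mulBy_one : mulBy (1 : MonoidAlgebra k G) M = 𝟙 M := by
  ext v
  change M.ρ.asAlgebraHom 1 v = v
  simp

/-- Correcting multiplication by `z` on the projective cover term by a lift of the factorization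
gives a map into the kernel whose restriction to the kernel is still multiplication by `z`. -/
lemma stablyTrivial_mulBy_syzygy {z : MonoidAlgebra k G} (h : StablyTrivial (mulBy z M)) :
    StablyTrivial (mulBy z (syzygy M)) := by
  change StablyTrivial (mulBy z (kernel (Projective.π M)))
  obtain ⟨Q, a, b, hQ, hab⟩ := h
  let c : Q ⟶ Projective.over M := Projective.factorThru b (Projective.π M)
  have hc : c ≫ Projective.π M = b := Projective.factorThru_comp _ _
  let d : Projective.over M ⟶ kernel (Projective.π M) :=
    kernel.lift (Projective.π M) (mulBy z (Projective.over M) - Projective.π M ≫ a ≫ c) (by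
      rw [Preadditive.sub_comp, mulBy_comp, Category.assoc, Category.assoc, hc, hab, sub_self])
  refine ⟨Projective.over M, kernel.ι (Projective.π M), d, inferInstance, ?_⟩
  refine (cancel_mono (kernel.ι (Projective.π M))).1 ?_
  rw [Category.assoc, kernel.lift_ι, Preadditive.comp_sub, kernel.condition_assoc, zero_comp,
    sub_zero]
  exact (mulBy_comp z _).symm

lemma stablyTrivial_mulBy_cosyzygy [Finite G] {z : MonoidAlgebra k G}
    (h : StablyTrivial (mulBy z M)) : StablyTrivial (mulBy z (cosyzygy M)) := by
  change StablyTrivial (mulBy z (cokernel (Injective.ι M)))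
  cases nonempty_fintype G
  obtain ⟨t, ht⟩ := stablyTrivial_iff.1 h
  obtain ⟨s, hs⟩ := LinearMap.exists_leftInverse_of_injective (Injective.ι M).hom.toLinearMap
    (LinearMap.ker_eq_bot.2 ((Rep.mono_iff_injective (Injective.ι M)).1 inferInstance))
  -- `t ∘ₗ s` extends `t` linearly to the injective module, so its trace extends multiplication by
  -- `z`.
  let c : Injective.under M ⟶ M := relTrace (t ∘ₗ s)
  have hc : Injective.ι M ≫ c = mulBy z M := by
    rw [comp_relTrace, LinearMap.comp_assoc, hs, LinearMap.comp_id, ht]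
  let d : cokernel (Injective.ι M) ⟶ Injective.under M :=
    cokernel.desc (Injective.ι M) (mulBy z (Injective.under M) - c ≫ Injective.ι M) (by
      rw [Preadditive.comp_sub, reassoc_of% hc, mulBy_comp, sub_self])
  refine ⟨Injective.under M, d, cokernel.π (Injective.ι M),
    projective_of_injective inferInstance, ?_⟩
  refine (cancel_epi (cokernel.π (Injective.ι M))).1 ?_
  rw [← Category.assoc, cokernel.π_desc, Preadditive.sub_comp, Category.assoc, cokernel.condition,
    comp_zero, sub_zero]
  exact mulBy_comp z _

lemma stablyTrivial_mulBy_heller [Finite G] {z : MonoidAlgebra k G}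
    (h : StablyTrivial (mulBy z M)) (i : ℤ) : StablyTrivial (mulBy z (heller M i)) := by
  rcases i with n | n
  · change StablyTrivial (mulBy z (syzygy^[n] M))
    induction n with
    | zero => exact h
    | succ n ih =>
      rw [Function.iterate_succ_apply']
      exact stablyTrivial_mulBy_syzygy ih
  · change StablyTrivial (mulBy z (cosyzygy^[n + 1] M))
    induction n with
    | zero => exact stablyTrivial_mulBy_cosyzygy h
    | succ n ih =>
      rw [Function.iterate_succ_apply']
      exact stablyTrivial_mulBy_cosyzygy ih

/-- An element annihilating the trivial module acts as a ghost on every module. -/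
lemma isGhost_mulBy [Finite G] {z : MonoidAlgebra k G}
    (hz : mulBy z (Rep.trivial k G k) = 0) (M : Rep.{u} k G) : IsGhost (mulBy z M) := by
  intro i φ
  rw [← mulBy_comp]
  refine (stablyTrivial_mulBy_heller ?_ i).comp_right φ
  cases nonempty_fintype G
  rw [hz, stablyTrivial_iff]
  refine ⟨0, ?_⟩
  ext
  exact (relTrace_apply _ _).trans (by simp)

end CentralAction

section Annihilators

variable {k G : Type u} [Field k] [CommGroup G]

/-- The elements of `M` annihilated by an ideal of the group algebra. -/
def annihilated (I : Ideal (MonoidAlgebra k G)) (M : Rep.{u} k G) : Submodule k M where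
  carrier := {v | ∀ z ∈ I, M.ρ.asAlgebraHom z v = 0}
  add_mem' hv hw z hz := by simp [hv z hz, hw z hz]
  zero_mem' z _ := by simp
  smul_mem' c v hv z hz := by simp [hv z hz]

lemma annihilated_le_comap (I : Ideal (MonoidAlgebra k G)) (M : Rep.{u} k G) (g : G) :
    annihilated I M ≤ (annihilated I M).comap (M.ρ g) := by
  intro v hv z hz
  have := hom_asAlgebraHom (M.applyAsHom g) z v
  rw [hv z hz, map_zero] at this
  exact this.symm

end Annihilators

/-! ### Upper bound: composites of ghosts kill socle layers -/

section UpperBound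

variable {k G : Type u} [Field k] [CommGroup G] [Fintype G] {L M N : Rep.{u} k G}

/-- An invariant vector is a map from k = Ω⁰ k, and a trace out of k takes 1 to a norm. Only degree
0 of the ghost condition is used. -/
lemma exists_norm_eq_of_isGhost {f : M ⟶ N} (hf : IsGhost f) {v : M} (hv : ∀ g, M.ρ g v = v) :
    ∃ w : N, N.ρ.norm w = f.hom v := by
  let φ : Rep.trivial k G k ⟶ M := Rep.ofHom (ρ := Representation.trivial k G k) (σ := M.ρ)
    (LinearMap.intertwiningMap_of_isIntertwiningMap _ M.ρ (LinearMap.toSpanSingleton k M v)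
      fun g c ↦ by simp [hv])
  obtain ⟨h, hh⟩ : ∃ h : k →ₗ[k] N, relTrace (M := Rep.trivial k G k) h = φ ≫ f :=
    stablyTrivial_iff.1 (hf 0 φ)
  refine ⟨h (1 : k), ?_⟩
  have h₁ : (relTrace (M := Rep.trivial k G k) h).hom (1 : k) = f.hom v := by
    rw [hh]
    change f.hom ((1 : k) • v) = f.hom v
    rw [one_smul]
  rw [← h₁, relTrace_apply, Representation.norm, LinearMap.sum_apply]
  exact Fintype.sum_bijective (·⁻¹) inv_involutive.bijective _ _ fun g ↦ by
    rw [inv_inv]; rfl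

/-- A map that sends invariants to norms agrees on invariants with a relative trace. -/
lemma exists_relTrace_eq_on_invariants {f : M ⟶ N}
    (hf : ∀ v : M, (∀ g, M.ρ g v = v) → ∃ w : N, N.ρ.norm w = f.hom v) :
    ∃ h : M →ₗ[k] N, ∀ v : M, (∀ g, M.ρ g v = v) → (relTrace h).hom v = f.hom v := by
  let F : M.ρ.invariants →ₗ[k] LinearMap.range N.ρ.norm :=
    (f.hom.toLinearMap ∘ₗ M.ρ.invariants.subtype).codRestrict _ fun v ↦ hf v v.2
  obtain ⟨s, hs⟩ := LinearMap.exists_rightInverse_of_surjective N.ρ.norm.rangeRestrict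
    (LinearMap.range_rangeRestrict _)
  obtain ⟨h, hh⟩ := LinearMap.exists_extend (s ∘ₗ F)
  refine ⟨h, fun v hv ↦ ?_⟩
  have h₁ : h v = s (F ⟨v, hv⟩) := LinearMap.congr_fun hh ⟨v, hv⟩
  have h₂ : N.ρ.norm (h v) = f.hom v := by
    rw [h₁]
    exact congrArg Subtype.val (LinearMap.congr_fun hs (F ⟨v, hv⟩))
  rw [← h₂, relTrace_apply, Representation.norm, LinearMap.sum_apply]
  exact Fintype.sum_bijective (·⁻¹) inv_involutive.bijective _ _ fun g ↦ by rw [hv]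

/-- A composite of `n` ghosts agrees stably with a map vanishing on the elements annihilated by
the `n`-th power of an ideal containing all `g - 1`. -/
lemma IsGhostComposite.exists_vanishing {I : Ideal (MonoidAlgebra k G)}
    (hI : ∀ g, MonoidAlgebra.of k G g - 1 ∈ I) {n : ℕ} {g : M ⟶ N} (hg : IsGhostComposite n g) :
    ∀ {L : Rep.{u} k G} (φ : L ⟶ M), ∃ θ τ : L ⟶ N, StablyTrivial τ ∧ φ ≫ g = θ + τ ∧
      ∀ v ∈ annihilated (I ^ n) L, θ.hom v = 0 := by
  induction hg with
  | @id M hM =>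
    intro L φ
    refine ⟨φ, 0, stablyTrivial_iff.2 ⟨0, ?_⟩, by simp, fun v hv ↦ ?_⟩
    · ext v
      exact (relTrace_apply _ _).trans (by simp)
    · have := hv 1 (by simp)
      rw [map_one] at this
      have hv0 : v = 0 := this
      rw [hv0, map_zero]
  | @comp n M M' N f g _ hf _ ih =>
    intro L φ
    have hinv : ∀ v ∈ annihilated I L, ∀ x, L.ρ x v = v := fun v hv x ↦ by
      have := hv _ (hI x)
      simpa [sub_eq_zero] using this
    obtain ⟨h, hh⟩ := exists_relTrace_eq_on_invariants (f := φ ≫ f) fun v hv ↦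
      exists_norm_eq_of_isGhost hf (v := φ.hom v) fun x ↦ by rw [← Rep.hom_comm_apply, hv]
    let d : L ⟶ M' := φ ≫ f - relTrace h
    have hd : ∀ v ∈ annihilated I L, d.hom v = 0 := fun v hv ↦ by
      change (φ ≫ f).hom v - (relTrace h).hom v = 0
      rw [hh v (hinv v hv), sub_self]
    -- The source changes to this quotient, which is why the induction allows an arbitrary `φ` into
    -- `M`.
    let Q := L.quotient (annihilated I L) (annihilated_le_comap I L)
    let π : L ⟶ Q := L.mkQ (annihilated I L) (annihilated_le_comap I L)
    let ψ : Q ⟶ M' := Rep.ofHom (ρ := Q.ρ) (σ := M'.ρ)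
      (LinearMap.intertwiningMap_of_isIntertwiningMap Q.ρ M'.ρ
        ((annihilated I L).liftQ d.hom.toLinearMap hd) fun x v ↦ by
          obtain ⟨v, rfl⟩ := (annihilated I L).mkQ_surjective v
          exact Rep.hom_comm_apply d x v)
    have hψ : π ≫ ψ = d := by
      ext v
      rfl
    obtain ⟨θ, τ, hτ, hsum, hθ⟩ := ih ψ
    refine ⟨π ≫ θ, π ≫ τ + relTrace h ≫ g, (hτ.comp_left π).add
      ((stablyTrivial_iff.2 ⟨h, rfl⟩).comp_right g), ?_, fun v hv ↦ hθ (π.hom v) fun z hz ↦ ?_⟩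
    · have : φ ≫ f = π ≫ ψ + relTrace h := by rw [hψ]; simp [d]
      rw [← Category.assoc, this, Preadditive.add_comp, Category.assoc, hsum, Preadditive.comp_add,
        add_assoc]
    · rw [← hom_asAlgebraHom]
      refine (Submodule.Quotient.mk_eq_zero _).2 fun w hw ↦ ?_
      have := hv (w * z) (by rw [pow_succ']; exact Ideal.mul_mem_mul hw hz)
      simpa using this

/-- A map vanishing on the kernel of the norm is stably trivial. -/
lemma stablyTrivial_of_ker_norm {f : M ⟶ N} (hf : ∀ v : M, M.ρ.norm v = 0 → f.hom v = 0) :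
    StablyTrivial f := by
  obtain ⟨s, hs⟩ := LinearMap.exists_rightInverse_of_surjective M.ρ.norm.rangeRestrict
    (LinearMap.range_rangeRestrict _)
  obtain ⟨t, ht⟩ := LinearMap.exists_extend s
  -- The norm kills `g v - v`. Thus `f` lands in invariants, and the factors `g⁻¹` drop out of the
  -- trace of `f ∘ t`, leaving `f (t (norm v)) = f v`.
  have hinv (g : G) (v : M) : f.hom (M.ρ g v) = f.hom v := by
    rw [← sub_eq_zero, ← map_sub]
    exact hf _ (by simp)
  refine stablyTrivial_iff.2 ⟨f.hom.toLinearMap ∘ₗ t, ?_⟩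
  ext v
  change (relTrace _).hom v = f.hom v
  have h₁ : M.ρ.norm (t (M.ρ.norm v)) = M.ρ.norm v := by
    have h₂ : t (M.ρ.norm v) = s (M.ρ.norm.rangeRestrict v) :=
      LinearMap.congr_fun ht (M.ρ.norm.rangeRestrict v)
    rw [h₂]
    exact congrArg Subtype.val (LinearMap.congr_fun hs (M.ρ.norm.rangeRestrict v))
  have h₃ : f.hom (t (M.ρ.norm v)) = f.hom v := by
    rw [← sub_eq_zero, ← map_sub]
    exact hf _ (by rw [map_sub, h₁, sub_self])
  rw [relTrace_apply, ← h₃, Representation.norm, LinearMap.sum_apply, map_sum, map_sum]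
  refine Finset.sum_congr rfl fun g _ ↦ ?_
  change N.ρ g⁻¹ (f.hom _) = _
  rw [← Rep.hom_comm_apply, hinv]

/-- If `I ^ n` is spanned by the norm element, composites of `n` ghosts are stably trivial. -/
lemma IsGhostComposite.stablyTrivial {I : Ideal (MonoidAlgebra k G)}
    (hI : ∀ g, MonoidAlgebra.of k G g - 1 ∈ I) {n : ℕ}
    (hn : ∀ z ∈ I ^ n, ∃ c : k, z = c • ∑ g, MonoidAlgebra.of k G g) {f : M ⟶ N}
    (hf : IsGhostComposite n f) : StablyTrivial f := by
  obtain ⟨θ, τ, hτ, hsum, hθ⟩ := hf.exists_vanishing hI (𝟙 M)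
  rw [Category.id_comp] at hsum
  rw [hsum]
  refine (stablyTrivial_of_ker_norm fun v hv ↦ hθ v fun z hz ↦ ?_).add hτ
  obtain ⟨c, rfl⟩ := hn z hz
  rw [Representation.norm] at hv
  rw [map_smul, map_sum]
  simp only [Representation.asAlgebraHom_of, LinearMap.smul_apply, hv, smul_zero]

end UpperBound

/-! ### The radical of the group algebra -/

section GroupAlgebra

variable {k G : Type u} [Field k] [CommGroup G]

lemma charP_monoidAlgebra (p : ℕ) [CharP k p] : CharP (MonoidAlgebra k G) p :=
  charP_of_injective_algebraMap (algebraMap k (MonoidAlgebra k G)).injective p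

lemma mem_jacobson_iff_isNilpotent [Finite G] {z : MonoidAlgebra k G} :
    z ∈ Ring.jacobson (MonoidAlgebra k G) ↔ IsNilpotent z := by
  have : IsArtinianRing (MonoidAlgebra k G) := isArtinian_of_tower k inferInstance
  rw [Ring.jacobson_eq_nilradical_of_krullDimLE_zero, mem_nilradical]

lemma isNilpotent_jacobson [Finite G] : IsNilpotent (Ring.jacobson (MonoidAlgebra k G)) := by
  have : IsArtinianRing (MonoidAlgebra k G) := isArtinian_of_tower k inferInstance
  rw [← Ideal.jacobson_bot]
  exact IsArtinianRing.isNilpotent_jacobson_bot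

lemma of_sub_one_mem_jacobson [Finite G] {p : ℕ} [Fact p.Prime] [CharP k p] (hG : IsPGroup p G)
    (g : G) : MonoidAlgebra.of k G g - 1 ∈ Ring.jacobson (MonoidAlgebra k G) := by
  have := charP_monoidAlgebra (k := k) (G := G) p
  obtain ⟨n, hn⟩ := hG g
  refine mem_jacobson_iff_isNilpotent.2 ⟨p ^ n, ?_⟩
  rw [sub_pow_char_pow, ← map_pow, hn, map_one, one_pow, sub_self]

/-- On the one-dimensional module k, a nilpotent element acts by a nilpotent scalar. -/
lemma mulBy_trivial_eq_zero [Finite G] {z : MonoidAlgebra k G}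
    (hz : z ∈ Ring.jacobson (MonoidAlgebra k G)) : mulBy z (Rep.trivial k G k) = 0 := by
  let e := (Representation.trivial k G k).asAlgebraHom
  have hpow (n : ℕ) : e (z ^ n) 1 = (e z 1) ^ n := by
    induction n with
    | zero => simp
    | succ n ih =>
      have h₁ : e (z ^ (n + 1)) 1 = e (z ^ n) (e z 1 • 1) := by simp [pow_succ]
      rw [h₁, map_smul, ih, smul_eq_mul, pow_succ']
  obtain ⟨n, hn⟩ := mem_jacobson_iff_isNilpotent.1 hz
  have h₀ : e z 1 = 0 := by
    refine eq_zero_of_pow_eq_zero (n := n) ?_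
    rw [← hpow, hn, map_zero, LinearMap.zero_apply]
  refine Rep.hom_ext (Representation.IntertwiningMap.ext (LinearMap.ext_ring ?_))
  exact h₀

/-- Translation invariance makes all coefficients equal to the one at 1. -/
lemma exists_eq_smul_sum_of [Fintype G] {z : MonoidAlgebra k G}
    (hz : ∀ g, (MonoidAlgebra.of k G g - 1) * z = 0) :
    ∃ c : k, z = c • ∑ g, MonoidAlgebra.of k G g := by
  classical
  refine ⟨z.coeff 1, MonoidAlgebra.ext (Finsupp.ext fun g ↦ ?_)⟩
  have h : MonoidAlgebra.of k G g * z = z := by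
    simpa [sub_mul, sub_eq_zero] using hz g
  have h₁ : (MonoidAlgebra.of k G g * z).coeff g = z.coeff 1 := by
    simp [MonoidAlgebra.of_apply]
  rw [h] at h₁
  rw [h₁]
  simp [MonoidAlgebra.coeff_sum, MonoidAlgebra.of_apply, Finsupp.single_apply]

end GroupAlgebra

lemma exists_projection_of_isCompl {G : Type*} [CommGroup G] {C H : Subgroup G}
    (h : IsCompl C H) :
    ∃ π : G →* G, (∀ c ∈ C, π c = 1) ∧ ∀ g, g / π g ∈ C := by
  have hc : H.IsComplement' C := by
    refine Subgroup.isComplement'_of_disjoint_and_mul_eq_univ h.disjoint.symm ?_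
    rw [← Subgroup.mul_normal, sup_comm, h.sup_eq_top, Subgroup.coe_top]
  refine ⟨H.subtype.comp (hc.QuotientMulEquiv.toMonoidHom.comp (QuotientGroup.mk' C)),
    fun c hcC ↦ ?_, fun g ↦ ?_⟩
  · have : QuotientGroup.mk' C c = 1 := (QuotientGroup.eq_one_iff c).2 hcC
    change (hc.QuotientMulEquiv (QuotientGroup.mk' C c) : G) = 1
    rw [this, map_one, Subgroup.coe_one]
  · have h₁ : ((hc.QuotientMulEquiv (g : G ⧸ C) : G) : G ⧸ C) = g :=
      hc.QuotientMulEquiv.symm_apply_apply (g : G ⧸ C)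
    rw [← QuotientGroup.eq_one_iff, QuotientGroup.mk_div, div_eq_one]
    exact h₁.symm

/-! ### Lower bound: a module on which traces vanish -/

section LowerBound

variable {k G : Type u} [Field k] [CommGroup G]

/-- The group algebra, with `G` acting through an endomorphism `π`. -/
noncomputable def twistedRep (k : Type u) {G : Type u} [Field k] [CommGroup G] (π : G →* G) :
    Rep.{u} k G :=
  Rep.of (((Algebra.lmul k (MonoidAlgebra k G)).toRingHom.toMonoidHom.comp
    (MonoidAlgebra.of k G)).comp π : Representation k G (MonoidAlgebra k G))

lemma twistedRep_ρ_apply (π : G →* G) (g : G) (v : MonoidAlgebra k G) :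
    (twistedRep k π).ρ g v = MonoidAlgebra.of k G (π g) * v := rfl

lemma twistedRep_asAlgebraHom (π : G →* G) (z v : MonoidAlgebra k G) :
    (twistedRep k π).ρ.asAlgebraHom z v = MonoidAlgebra.mapDomainAlgHom k k π z * v := by
  induction z using MonoidAlgebra.induction_on with
  | of g =>
    rw [Representation.asAlgebraHom_of, twistedRep_ρ_apply,
      show MonoidAlgebra.mapDomainAlgHom k k π (MonoidAlgebra.of k G g) =
        MonoidAlgebra.of k G (π g) by simp]
  | add x y hx hy =>
    rw [map_add, map_add, add_mul, ← hx, ← hy]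
    rfl
  | smul r x hx =>
    rw [map_smul, map_smul, smul_mul_assoc, ← hx]
    rfl

/-- In characteristic `2`, relative traces vanish on modules on which an element of order `2`
acts trivially. -/
lemma relTrace_eq_zero [Fintype G] [CharP k 2] {M N : Rep.{u} k G} {σ : G} (hσ : σ ≠ 1)
    (hσ₂ : σ * σ = 1) (hM : ∀ v, M.ρ σ v = v) (hN : ∀ v, N.ρ σ v = v) (h : M →ₗ[k] N) :
    relTrace h = 0 := by
  have hσ' : σ⁻¹ = σ := inv_eq_of_mul_eq_one_left hσ₂
  ext v
  change (relTrace h).hom v = 0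
  rw [relTrace_apply]
  -- The terms at `g` and `g * σ` coincide, so they cancel in pairs.
  refine Finset.sum_involution (fun g _ ↦ g * σ) (fun g _ ↦ ?_) (fun g _ _ ↦ by simpa using hσ)
    (fun _ _ ↦ Finset.mem_univ _) (fun g _ ↦ by rw [mul_assoc, hσ₂, mul_one])
  rw [mul_inv_rev, hσ', map_mul, map_mul, Module.End.mul_apply, Module.End.mul_apply, hM, hN,
    ← two_smul k, CharTwo.two_eq_zero, zero_smul]

lemma eq_zero_of_stablyTrivial_mulBy [Finite G] [CharP k 2] {π : G →* G} {σ : G} (hσ : σ ≠ 1)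
    (hσ₂ : σ * σ = 1) (hπ : π σ = 1) {z : MonoidAlgebra k G}
    (hz : StablyTrivial (mulBy z (twistedRep k π))) :
    MonoidAlgebra.mapDomainAlgHom k k π z = 0 := by
  cases nonempty_fintype G
  have htriv (v : MonoidAlgebra k G) : (twistedRep k π).ρ σ v = v := by
    rw [twistedRep_ρ_apply, hπ, map_one, one_mul]
  obtain ⟨h, hh⟩ := stablyTrivial_iff.1 hz
  rw [relTrace_eq_zero hσ hσ₂ htriv htriv] at hh
  have h₁ : (twistedRep k π).ρ.asAlgebraHom z (1 : MonoidAlgebra k G) = 0 := by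
    change (mulBy z (twistedRep k π)).hom _ = 0
    rw [← hh]
    rfl
  rwa [twistedRep_asAlgebraHom, mul_one] at h₁

/-- Multiplications by products of `n` elements of the radical are composites of `n` ghosts. -/
lemma jacobson_pow_le_span [Finite G] (M : Rep.{u} k G) (hM : FiniteDimensional k M) (n : ℕ) :
    Ring.jacobson (MonoidAlgebra k G) ^ n ≤
      Ideal.span {z : MonoidAlgebra k G | IsGhostComposite n (mulBy z M)} := by
  induction n with
  | zero =>
    have : (1 : MonoidAlgebra k G) ∈ Ideal.span
        {z : MonoidAlgebra k G | IsGhostComposite 0 (mulBy z M)} := by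
      refine Ideal.subset_span ?_
      rw [Set.mem_ofPred_eq, mulBy_one]
      exact .id M hM
    rw [(Ideal.eq_top_iff_one _).2 this]
    exact le_top
  | succ n ih =>
    rw [pow_succ']
    refine (Ideal.mul_mono (Ideal.span_eq (Ring.jacobson (MonoidAlgebra k G))).ge ih).trans ?_
    rw [Ideal.span_mul_span']
    refine Ideal.span_mono ?_
    rintro _ ⟨a, ha, b, hb, rfl⟩
    change IsGhostComposite (n + 1) (mulBy (a * b) M)
    rw [mul_comm, mulBy_mul]
    exact .comp _ _ hM (isGhost_mulBy (mulBy_trivial_eq_zero ha) M) hb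

variable {π : G →* G} {σ : G}

lemma sub_mapDomain_mem (hσ : ∀ g, g = π g ∨ g = σ * π g) (w : MonoidAlgebra k G) :
    w - MonoidAlgebra.mapDomainAlgHom k k π w ∈ Ideal.span {MonoidAlgebra.of k G σ - 1} := by
  induction w using MonoidAlgebra.induction_on with
  | of g =>
    have h₁ : MonoidAlgebra.mapDomainAlgHom k k π (MonoidAlgebra.of k G g) =
        MonoidAlgebra.of k G (π g) := by simp
    rw [h₁]
    rcases hσ g with h | h
    · rw [← h, sub_self]
      exact Ideal.zero_mem _
    · refine Ideal.mem_span_singleton.2 ⟨MonoidAlgebra.of k G (π g), ?_⟩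
      rw [sub_mul, one_mul, ← map_mul, ← h]
  | add x y hx hy =>
    rw [map_add, add_sub_add_comm]
    exact Ideal.add_mem _ hx hy
  | smul r x hx =>
    rw [map_smul, ← smul_sub]
    exact Submodule.smul_of_tower_mem _ r hx

/-- Induction on products, by ab - π(a)π(b) = (a - π(a))b + π(a)(b - π(b)); π preserves the radical
because it preserves nilpotency. -/
lemma sub_mapDomain_mem_of_mem_pow [Finite G] (hσ : ∀ g, g = π g ∨ g = σ * π g) (n : ℕ)
    {w : MonoidAlgebra k G} (hw : w ∈ Ring.jacobson (MonoidAlgebra k G) ^ (n + 1)) :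
    w - MonoidAlgebra.mapDomainAlgHom k k π w ∈
      Ideal.span {MonoidAlgebra.of k G σ - 1} * Ring.jacobson (MonoidAlgebra k G) ^ n := by
  induction n generalizing w with
  | zero => simpa using sub_mapDomain_mem hσ w
  | succ n ih =>
    rw [pow_succ'] at hw
    induction hw using Submodule.mul_induction_on' with
    | mem_mul_mem a ha b hb =>
      rw [map_mul]
      have h₁ : MonoidAlgebra.mapDomainAlgHom k k π a ∈ Ring.jacobson (MonoidAlgebra k G) :=
        mem_jacobson_iff_isNilpotent.2 ((mem_jacobson_iff_isNilpotent.1 ha).map _)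
      have h₂ := Ideal.add_mem _ (Ideal.mul_mem_mul (sub_mapDomain_mem hσ a) hb)
        (pow_succ' (Ring.jacobson (MonoidAlgebra k G)) n ▸
          mul_left_comm (Ring.jacobson (MonoidAlgebra k G)) _ _ ▸ Ideal.mul_mem_mul h₁ (ih hb))
      convert h₂ using 1
      ring
    | add x _ y _ hx hy =>
      rw [map_add, add_sub_add_comm]
      exact Ideal.add_mem _ hx hy

/-- If π kills J ^ n, then J ^ n lies in (σ - 1) and J ^ (n + 1) in (σ - 1) J ^ n, hence in (σ -
1)², which is zero in characteristic 2. -/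
lemma exists_mapDomain_ne_zero [Finite G] [CharP k 2] (hσ : ∀ g, g = π g ∨ g = σ * π g)
    (hσ₂ : σ * σ = 1) {n : ℕ} (hn : Ring.jacobson (MonoidAlgebra k G) ^ (n + 1) ≠ ⊥) :
    ∃ w ∈ Ring.jacobson (MonoidAlgebra k G) ^ n,
      MonoidAlgebra.mapDomainAlgHom k k π w ≠ 0 := by
  by_contra! h
  have := charP_monoidAlgebra (k := k) (G := G) 2
  have hx : (MonoidAlgebra.of k G σ - 1) * (MonoidAlgebra.of k G σ - 1) = 0 := by
    rw [← sq, sub_pow_char, ← map_pow, sq, hσ₂, map_one, one_pow, sub_self]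
  refine hn (eq_bot_iff.2 fun w hw ↦ ?_)
  have h₁ := sub_mapDomain_mem_of_mem_pow hσ n hw
  rw [h w (Ideal.pow_le_pow_right n.le_succ hw), sub_zero] at h₁
  refine Ideal.mul_le.2 (fun a ha v hv ↦ ?_) h₁
  obtain ⟨a, rfl⟩ := Ideal.mem_span_singleton.1 ha
  have h₂ := sub_mapDomain_mem hσ v
  rw [h v hv, sub_zero] at h₂
  obtain ⟨v, rfl⟩ := Ideal.mem_span_singleton.1 h₂
  rw [Submodule.mem_bot, mul_mul_mul_comm, hx, zero_mul]

end LowerBound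

end GhostNumber

theorem mainTheorem2 (k G : Type u) [Field k] [CharP k 2] [CommGroup G] [Finite G]
    (hG : IsPGroup 2 G)
    (hC : ∃ C H : Subgroup G, Nat.card C = 2 ∧ IsCompl C H) :
    ∃ l : ℕ, GhostNumber.IsGhostNumber k G l ∧
      GhostNumber.IsNilpotencyIndex (Ring.jacobson (MonoidAlgebra k G)) (l + 1) := by
  classical
  cases nonempty_fintype G
  let J := Ring.jacobson (MonoidAlgebra k G)
  have hnil : ∃ m, J ^ m = ⊥ := GhostNumber.isNilpotent_jacobson
  obtain ⟨l, hl⟩ : ∃ l, Nat.find hnil = l + 1 := Nat.exists_eq_succ_of_ne_zero fun h₀ ↦ by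
    have h := Nat.find_spec hnil
    rw [h₀, pow_zero, Ideal.one_eq_top] at h
    exact top_ne_bot h
  have hbot : J ^ (l + 1) = ⊥ := hl ▸ Nat.find_spec hnil
  have hne : J ^ l ≠ ⊥ := Nat.find_min hnil (by lia)
  have hmem : ∀ g, MonoidAlgebra.of k G g - 1 ∈ J := GhostNumber.of_sub_one_mem_jacobson hG
  refine ⟨l, ⟨fun M N f hf ↦ hf.stablyTrivial hmem fun z hz ↦
    GhostNumber.exists_eq_smul_sum_of fun g ↦ ?_, fun n hn ↦ ?_⟩,
    hbot, fun m hm ↦ hl ▸ Nat.find_min' hnil hm⟩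
  · have : (MonoidAlgebra.of k G g - 1) * z ∈ J ^ (l + 1) := by
      rw [pow_succ']
      exact Ideal.mul_mem_mul (hmem g) hz
    rwa [hbot] at this
  · obtain ⟨C, H, hcard, hCH⟩ := hC
    obtain ⟨⟨σ, hσC⟩, hσ, huniq⟩ := (Nat.card_eq_two_iff' (1 : C)).1 hcard
    have hσ₁ : σ ≠ 1 := fun h ↦ hσ (Subtype.ext h)
    have hcases (c : G) (hc : c ∈ C) : c = 1 ∨ c = σ := by
      by_cases h : c = 1
      · exact .inl h
      · exact .inr (congrArg Subtype.val (huniq ⟨c, hc⟩ fun h' ↦ h (congrArg Subtype.val h')))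
    have hσ₂ : σ * σ = 1 := (hcases _ (C.mul_mem hσC hσC)).resolve_right (by simpa using hσ₁)
    obtain ⟨π, hπ, hdiv⟩ := GhostNumber.exists_projection_of_isCompl hCH
    have hdecomp (g : G) : g = π g ∨ g = σ * π g :=
      (hcases _ (hdiv g)).imp div_eq_one.1 div_eq_iff_eq_mul.1
    by_contra! hlt
    obtain ⟨l, rfl⟩ : ∃ m, l = m + 1 := ⟨l - 1, by lia⟩
    obtain ⟨w, hw, hwne⟩ := GhostNumber.exists_mapDomain_ne_zero hdecomp hσ₂ hne
    refine hwne ?_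
    have hfin : FiniteDimensional k (GhostNumber.twistedRep k π) :=
      inferInstanceAs (FiniteDimensional k (MonoidAlgebra k G))
    have hle := GhostNumber.jacobson_pow_le_span (GhostNumber.twistedRep k π) hfin n
    -- The generators of J ^ n lie in the kernel of π; since that kernel is an ideal, it contains
    -- all of J ^ n, and `w` with it.
    refine (hle.trans (Ideal.span_le (I := RingHom.ker (MonoidAlgebra.mapDomainAlgHom k k π)).2
      fun z hz ↦ ?_)) (Ideal.pow_le_pow_right (by lia) hw)
    exact GhostNumber.eq_zero_of_stablyTrivial_mulBy hσ₁ hσ₂ (hπ σ hσC) (hn _ _ _ hz)
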